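/- For $z\in\mathbb{C}\setminus\{0\}$ let $W_{3,8}^z$ and $W_{3,9}^z$ be the connected closed subgroups of $\mathrm{SL}_3(\mathbb{R})$ $$W_{3,8}^z=\left\{\begin{pmatrix} e^{zt} & w\\ 0 & e^{-2\Re(z)t}\end{pmatrix} : t\in\mathbb{R},\ w\in\mathbb{R}^{2\times 1}\right\},\qquad W_{3,9}^z=\left\{\begin{pmatrix} e^{-2\Re(z)t} & w\\ 0 & e^{zt}\end{pmatrix} : t\in\mathbb{R},\ w\in\mathbb{R}^{1\times 2}\right\},$$ where a complex number $a+bi$ is identified with the real $2\times 2$ matrix $\begin{pmatrix} a & b\\ -b & a\end{pmatrix}$. A sequence of subgroups $H_n$ of $G=\mathrm{SL}_3(\mathbb{R})$ converges to a subgroup $L\le G$ in the Chabauty sense if (1) every $h\in L$ is the limit of some sequence $h_n\in H_n$, and (2) whenever $h_n\in H_n$ for all $n$ and a subsequence $h_{n_k}$ converges to $h\in G$, then $h\in L$. **Lemma.** Let $z\in\mathbb{C}$, $z\neq 0$, let $H=W_{3,8}^z$ or $H=W_{3,9}^z$, and let $g_n\in \mathrm{SL}_3(\mathbb{R})$ be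 a sequence such that $g_nHg_n^{-1}$ converges to a subgroup $L\le \mathrm{SL}_3(\mathbb{R})$. Then $L$ is a closed subgroup of dimension $3$; that is, its Lie algebra $\{X\in M_3(\mathbb{R}) : \exp(tX)\in L \text{ for all } t\in\mathbb{R}\}$ is a real vector space of dimension $3$. -/

import Mathlib

open Filter Topology

/-- The matrix with the `2 × 2` block of `e ^ (z t)` in the upper left corner, the column `(u, v)`
to the right of it and `e ^ (-2 Re(z) t)` in the lower right corner. A complex number `a + b i` is
identified with the real matrix `!![a, b; -b, a]`. -/
noncomputable def W38Matrix (z : ℂ) (t u v : ℝ) : Matrix (Fin 3) (Fin 3) ℝ :=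
  !![(Complex.exp (z * t)).re, (Complex.exp (z * t)).im, u;
     -(Complex.exp (z * t)).im, (Complex.exp (z * t)).re, v;
     0, 0, Real.exp (-2 * z.re * t)]

/-- The matrix with `e ^ (-2 Re(z) t)` in the upper left corner, the row `(u, v)` to the right
of it and the `2 × 2` block of `e ^ (z t)` in the lower right corner. -/
noncomputable def W39Matrix (z : ℂ) (t u v : ℝ) : Matrix (Fin 3) (Fin 3) ℝ :=
  !![Real.exp (-2 * z.re * t), u, v;
     0, (Complex.exp (z * t)).re, (Complex.exp (z * t)).im;
     0, -(Complex.exp (z * t)).im, (Complex.exp (z * t)).re]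

theorem W38Matrix_mul (z : ℂ) (t u v t' u' v' : ℝ) :
    W38Matrix z t u v * W38Matrix z t' u' v' = W38Matrix z (t + t')
      ((Complex.exp (z * t)).re * u' + (Complex.exp (z * t)).im * v'
        + u * Real.exp (-2 * z.re * t'))
      (-(Complex.exp (z * t)).im * u' + (Complex.exp (z * t)).re * v'
        + v * Real.exp (-2 * z.re * t')) := by
  have h : Complex.exp (z * ((t + t' : ℝ) : ℂ)) = Complex.exp (z * t) * Complex.exp (z * t') := by
    rw [← Complex.exp_add]; push_cast; ring_nf
  have h2 : Real.exp (-2 * z.re * (t + t')) =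
      Real.exp (-2 * z.re * t) * Real.exp (-2 * z.re * t') := by
    rw [← Real.exp_add]; ring_nf
  ext i j
  fin_cases i <;> fin_cases j <;>
    simp [W38Matrix, h, h2, Matrix.mul_apply, Fin.sum_univ_three, -Complex.ofReal_add,
      -neg_mul] <;> ring

theorem W39Matrix_mul (z : ℂ) (t u v t' u' v' : ℝ) :
    W39Matrix z t u v * W39Matrix z t' u' v' = W39Matrix z (t + t')
      (Real.exp (-2 * z.re * t) * u' + u * (Complex.exp (z * t')).re
        - v * (Complex.exp (z * t')).im)
      (Real.exp (-2 * z.re * t) * v' + u * (Complex.exp (z * t')).im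
        + v * (Complex.exp (z * t')).re) := by
  have h : Complex.exp (z * ((t + t' : ℝ) : ℂ)) = Complex.exp (z * t) * Complex.exp (z * t') := by
    rw [← Complex.exp_add]; push_cast; ring_nf
  have h2 : Real.exp (-2 * z.re * (t + t')) =
      Real.exp (-2 * z.re * t) * Real.exp (-2 * z.re * t') := by
    rw [← Real.exp_add]; ring_nf
  ext i j
  fin_cases i <;> fin_cases j <;>
    simp [W39Matrix, h, h2, Matrix.mul_apply, Fin.sum_univ_three, -Complex.ofReal_add,
      -neg_mul] <;> ring

theorem W38Matrix_zero (z : ℂ) : W38Matrix z 0 0 0 = 1 := by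
  ext i j
  fin_cases i <;> fin_cases j <;> simp [W38Matrix]

theorem W39Matrix_zero (z : ℂ) : W39Matrix z 0 0 0 = 1 := by
  ext i j
  fin_cases i <;> fin_cases j <;> simp [W39Matrix]

theorem W38Matrix_exists_inv (z : ℂ) (t u v : ℝ) :
    ∃ t' u' v' : ℝ, W38Matrix z t' u' v' * W38Matrix z t u v = 1 := by
  refine ⟨-t, -((Complex.exp (z * (-t : ℝ))).re * u + (Complex.exp (z * (-t : ℝ))).im * v)
      * Real.exp (2 * z.re * t),
    -(-(Complex.exp (z * (-t : ℝ))).im * u + (Complex.exp (z * (-t : ℝ))).re * v)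
      * Real.exp (2 * z.re * t), ?_⟩
  have h : Real.exp (2 * z.re * t) * Real.exp (-2 * z.re * t) = 1 := by
    rw [← Real.exp_add]; ring_nf; simp
  rw [W38Matrix_mul, ← W38Matrix_zero z]
  congr 1
  · ring
  · linear_combination (-((Complex.exp (z * (-t : ℝ))).re * u
      + (Complex.exp (z * (-t : ℝ))).im * v)) * h
  · linear_combination (-(-(Complex.exp (z * (-t : ℝ))).im * u
      + (Complex.exp (z * (-t : ℝ))).re * v)) * h

theorem W39Matrix_exists_inv (z : ℂ) (t u v : ℝ) :
    ∃ t' u' v' : ℝ, W39Matrix z t u v * W39Matrix z t' u' v' = 1 := by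
  refine ⟨-t, -(u * (Complex.exp (z * (-t : ℝ))).re - v * (Complex.exp (z * (-t : ℝ))).im)
      * Real.exp (2 * z.re * t),
    -(u * (Complex.exp (z * (-t : ℝ))).im + v * (Complex.exp (z * (-t : ℝ))).re)
      * Real.exp (2 * z.re * t), ?_⟩
  have h : Real.exp (2 * z.re * t) * Real.exp (-2 * z.re * t) = 1 := by
    rw [← Real.exp_add]; ring_nf; simp
  rw [W39Matrix_mul, ← W39Matrix_zero z]
  congr 1
  · ring
  · linear_combination (-(u * (Complex.exp (z * (-t : ℝ))).re
      - v * (Complex.exp (z * (-t : ℝ))).im)) * h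
  · linear_combination (-(u * (Complex.exp (z * (-t : ℝ))).im
      + v * (Complex.exp (z * (-t : ℝ))).re)) * h

/-- The subgroup `W_{3,8}^z` of `SL(3, ℝ)`. -/
noncomputable def W38 (z : ℂ) : Subgroup (Matrix.SpecialLinearGroup (Fin 3) ℝ) where
  carrier := {A | ∃ t u v : ℝ, (A : Matrix (Fin 3) (Fin 3) ℝ) = W38Matrix z t u v}
  mul_mem' := by
    rintro A B ⟨t, u, v, hA⟩ ⟨t', u', v', hB⟩
    exact ⟨_, _, _, by rw [Matrix.SpecialLinearGroup.coe_mul, hA, hB, W38Matrix_mul]⟩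
  one_mem' := ⟨0, 0, 0, by rw [W38Matrix_zero, Matrix.SpecialLinearGroup.coe_one]⟩
  inv_mem' := by
    rintro A ⟨t, u, v, hA⟩
    obtain ⟨t', u', v', h⟩ := W38Matrix_exists_inv z t u v
    refine ⟨t', u', v', ?_⟩
    have h1 : (A : Matrix (Fin 3) (Fin 3) ℝ) * (A⁻¹ : Matrix.SpecialLinearGroup (Fin 3) ℝ) = 1 := by
      rw [← Matrix.SpecialLinearGroup.coe_mul, mul_inv_cancel, Matrix.SpecialLinearGroup.coe_one]
    rw [← hA] at h
    exact (left_inv_eq_right_inv h h1).symm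

/-- The subgroup `W_{3,9}^z` of `SL(3, ℝ)`. -/
noncomputable def W39 (z : ℂ) : Subgroup (Matrix.SpecialLinearGroup (Fin 3) ℝ) where
  carrier := {A | ∃ t u v : ℝ, (A : Matrix (Fin 3) (Fin 3) ℝ) = W39Matrix z t u v}
  mul_mem' := by
    rintro A B ⟨t, u, v, hA⟩ ⟨t', u', v', hB⟩
    exact ⟨_, _, _, by rw [Matrix.SpecialLinearGroup.coe_mul, hA, hB, W39Matrix_mul]⟩
  one_mem' := ⟨0, 0, 0, by rw [W39Matrix_zero, Matrix.SpecialLinearGroup.coe_one]⟩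
  inv_mem' := by
    rintro A ⟨t, u, v, hA⟩
    obtain ⟨t', u', v', h⟩ := W39Matrix_exists_inv z t u v
    refine ⟨t', u', v', ?_⟩
    have h1 : ((A⁻¹ : Matrix.SpecialLinearGroup (Fin 3) ℝ) : Matrix (Fin 3) (Fin 3) ℝ) * A = 1 := by
      rw [← Matrix.SpecialLinearGroup.coe_mul, inv_mul_cancel, Matrix.SpecialLinearGroup.coe_one]
    rw [← hA] at h
    exact left_inv_eq_right_inv h1 h

/-- Convergence of a sequence of subgroups in the Chabauty topology: every element of `L` is a
limit of elements of the `H n`, and every limit of a subsequence of a sequence with terms in the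
`H n` lies in `L`. -/
def ChabautyTendsto {G : Type*} [Group G] [TopologicalSpace G]
    (H : ℕ → Subgroup G) (L : Subgroup G) : Prop :=
  (∀ x ∈ L, ∃ h : ℕ → G, (∀ n, h n ∈ H n) ∧ Tendsto h atTop (𝓝 x)) ∧
  (∀ h : ℕ → G, (∀ n, h n ∈ H n) → ∀ φ : ℕ → ℕ, StrictMono φ →
    ∀ x : G, Tendsto (h ∘ φ) atTop (𝓝 x) → x ∈ L)

/-- `L` is a limit of conjugates of `H`: there is a sequence `p n` in `G` such that the subgroups
`p n * H * (p n)⁻¹` converge to `L`. -/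
def IsConjugacyLimit {G : Type*} [Group G] [TopologicalSpace G] (H L : Subgroup G) : Prop :=
  ∃ p : ℕ → G, ChabautyTendsto (fun n => H.map (MulAut.conj (p n)).toMonoidHom) L

/-- `L` is a closed subgroup of `SL(n, ℝ)` of dimension `d` as a Lie group: its Lie algebra, the
set of all matrices `X` such that the one-parameter group `exp (t X)` lies in `L`, is a real vector
space of dimension `d`. -/
def IsClosedOfDim {n : ℕ} (L : Subgroup (Matrix.SpecialLinearGroup (Fin n) ℝ)) (d : ℕ) : Prop :=
  IsClosed (L : Set (Matrix.SpecialLinearGroup (Fin n) ℝ)) ∧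
  ∃ V : Submodule ℝ (Matrix (Fin n) (Fin n) ℝ),
    (∀ X : Matrix (Fin n) (Fin n) ℝ, X ∈ V ↔
      ∀ t : ℝ, ∃ A ∈ L, (A : Matrix (Fin n) (Fin n) ℝ) = NormedSpace.exp (t • X)) ∧
    Module.finrank ℝ V = d

/-! ### Formal properties of Chabauty limits. -/

section ChabautyLimits

variable {G : Type*} [Group G] [TopologicalSpace G]

/-! The automorphism `dualAut` (inverse, transpose, reversal of the basis) carries `W39 z` to `W38
z`, so only `W38 z` needs an argument.

Every `p` in `SL(3, ℝ)` factors as `k * stretch s * n`, where `k` has entries bounded by 1, `s ≥ 1`,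
and `n` has a complex number as its upper left block and zeros below it
(`exists_compact_mul_stretch_mul_normalizer`). Such an `n` normalizes `W38 z` and disappears from
the conjugate. Along a subsequence `k` converges and `s⁻¹` tends to some `q` in `[0, 1]`; removing
the limit of `k` changes `L` only by a conjugation. What remains are limits of conjugates by
`stretch s` alone, treated in `isClosedOfDim_stretch_limit`.

If `z` is real, `stretch s` normalizes `W38 z` and the sequence is constant. If `q ≠ 0`, the limit
is a conjugate of `W38 z`. Otherwise `s → ∞` and `z.im ≠ 0`. The limit then contains all unipotent
upper triangular matrices (`unipotent_mem_stretch_limit`). It lies among the upper triangular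
matrices whose first two diagonal entries agree and whose corner takes values in a discrete set
(`mem_stretch_limit`). It may be disconnected, but its Lie algebra is the Heisenberg algebra, of
dimension 3. -/

theorem ChabautyTendsto.comp_strictMono {H : ℕ → Subgroup G} {L : Subgroup G}
    (hL : ChabautyTendsto H L) {ψ : ℕ → ℕ} (hψ : StrictMono ψ) :
    ChabautyTendsto (H ∘ ψ) L := by
  classical
  refine ⟨fun x hx => ?_, fun h hh φ hφ x hx => ?_⟩
  · obtain ⟨h, hh, hlim⟩ := hL.1 x hx
    exact ⟨h ∘ ψ, fun n => hh _, hlim.comp hψ.tendsto_atTop⟩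
  -- The closure condition needs a term in every `H n`, so indices outside the range of `ψ` are
  -- filled with the identity.
  · refine hL.2 (Function.extend ψ h 1) (fun n => ?_) (ψ ∘ φ) (hψ.comp hφ) x ?_
    · by_cases hn : ∃ m, ψ m = n
      · obtain ⟨m, rfl⟩ := hn
        rw [hψ.injective.extend_apply]
        exact hh m
      · rw [Function.extend_apply' _ _ _ hn]
        exact one_mem _
    · convert hx using 1
      ext n
      simp [hψ.injective.extend_apply]

theorem ChabautyTendsto.conj [IsTopologicalGroup G] {H : ℕ → Subgroup G} {L : Subgroup G}
    (hL : ChabautyTendsto H L) {k : ℕ → G} {k₀ : G} (hk : Tendsto k atTop (𝓝 k₀)) :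
    ChabautyTendsto (fun n => (H n).map (MulAut.conj (k n)).toMonoidHom)
      (L.map (MulAut.conj k₀).toMonoidHom) := by
  refine ⟨?_, fun h hh φ hφ x hx => ?_⟩
  · rintro _ ⟨x, hx, rfl⟩
    obtain ⟨h, hh, hlim⟩ := hL.1 x hx
    refine ⟨fun n => k n * h n * (k n)⁻¹, fun n => ⟨h n, hh n, rfl⟩, ?_⟩
    exact (hk.mul hlim).mul hk.inv
  · have hk' := hk.comp hφ.tendsto_atTop
    refine ⟨k₀⁻¹ * x * k₀, hL.2 (fun n => (k n)⁻¹ * h n * k n) (fun n => ?_) φ hφ _ ?_, ?_⟩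
    · obtain ⟨y, hy, hyh⟩ := hh n
      have : (k n)⁻¹ * h n * k n = y := by
        rw [← hyh]; simp [MulAut.conj_apply, mul_assoc]
      exact this ▸ hy
    · exact (hk'.inv.mul hx).mul hk'
    · simp [MulAut.conj_apply, mul_assoc]

theorem ChabautyTendsto.map {G' : Type*} [Group G'] [TopologicalSpace G']
    {H : ℕ → Subgroup G} {L : Subgroup G} (hL : ChabautyTendsto H L) (e : G ≃* G')
    (he : Continuous e) (he' : Continuous e.symm) :
    ChabautyTendsto (fun n => (H n).map e.toMonoidHom) (L.map e.toMonoidHom) := by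
  refine ⟨?_, fun h hh φ hφ x hx => ?_⟩
  · rintro _ ⟨x, hx, rfl⟩
    obtain ⟨h, hh, hlim⟩ := hL.1 x hx
    exact ⟨fun n => e (h n), fun n => ⟨h n, hh n, rfl⟩, (he.tendsto x).comp hlim⟩
  · refine ⟨e.symm x, hL.2 (fun n => e.symm (h n)) (fun n => ?_) φ hφ _
      ((he'.tendsto x).comp hx), by simp⟩
    obtain ⟨y, hy, hyh⟩ := hh n
    rw [← hyh]
    simpa using hy

theorem IsConjugacyLimit.map {G' : Type*} [Group G'] [TopologicalSpace G']
    {H L : Subgroup G} (hL : IsConjugacyLimit H L) (e : G ≃* G')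
    (he : Continuous e) (he' : Continuous e.symm) :
    IsConjugacyLimit (H.map e.toMonoidHom) (L.map e.toMonoidHom) := by
  obtain ⟨p, hp⟩ := hL
  refine ⟨fun n => e (p n), ?_⟩
  convert hp.map e he he' using 2 with n
  rw [Subgroup.map_map, Subgroup.map_map]
  congr 1
  ext x
  simp [MulAut.conj_apply]

/-- A diagonal choice along a countable decreasing basis at `x` produces a subsequence converging to
`x`. -/
theorem ChabautyTendsto.mem_of_frequently [FirstCountableTopology G]
    {H : ℕ → Subgroup G} {L : Subgroup G} (hL : ChabautyTendsto H L) {x : G}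
    (hx : ∀ U ∈ 𝓝 x, ∃ᶠ n in atTop, ∃ y ∈ H n, y ∈ U) : x ∈ L := by
  classical
  obtain ⟨B, hB⟩ := (𝓝 x).exists_antitone_basis
  obtain ⟨φ, hφ, hφB⟩ := extraction_forall_of_frequently fun k => hx (B k) (hB.mem k)
  choose y hy hyB using hφB
  refine hL.2 (Function.extend φ y 1) (fun n => ?_) φ hφ x ?_
  · by_cases hn : ∃ m, φ m = n
    · obtain ⟨m, rfl⟩ := hn
      rw [hφ.injective.extend_apply]
      exact hy m
    · rw [Function.extend_apply' _ _ _ hn]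
      exact one_mem _
  · convert hB.tendsto hyB using 1
    ext n
    simp [hφ.injective.extend_apply]

theorem ChabautyTendsto.isClosed [FirstCountableTopology G]
    {H : ℕ → Subgroup G} {L : Subgroup G} (hL : ChabautyTendsto H L) :
    IsClosed (L : Set G) := by
  refine isClosed_of_closure_subset fun x hx => hL.mem_of_frequently fun U hU => ?_
  obtain ⟨V, hVU, hV, hxV⟩ := mem_nhds_iff.1 hU
  obtain ⟨y, hyV, hyL⟩ := mem_closure_iff.1 hx V hV hxV
  obtain ⟨h, hh, hlim⟩ := hL.1 y hyL
  refine Eventually.frequently ?_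
  filter_upwards [hlim.eventually (hV.mem_nhds hyV)] with n hn
  exact ⟨h n, hh n, hVU hn⟩

theorem ChabautyTendsto.eq_of_const {H L : Subgroup G}
    (hL : ChabautyTendsto (fun _ => H) L) (hH : IsClosed (H : Set G)) : L = H := by
  refine le_antisymm (fun x hx => ?_) fun x hx => ?_
  · obtain ⟨h, hh, hlim⟩ := hL.1 x hx
    exact hH.mem_of_tendsto hlim (Eventually.of_forall hh)
  · exact hL.2 (fun _ => x) (fun _ => hx) id strictMono_id x tendsto_const_nhds

end ChabautyLimits

theorem Matrix.SpecialLinearGroup.tendsto_iff {n : Type*} [DecidableEq n] [Fintype n]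
    {α : Type*} {l : Filter α} {f : α → Matrix.SpecialLinearGroup n ℝ}
    {A : Matrix.SpecialLinearGroup n ℝ} :
    Tendsto f l (𝓝 A) ↔ ∀ i j, Tendsto (fun a => (f a : Matrix n n ℝ) i j) l (𝓝 (A i j)) := by
  refine Matrix.SpecialLinearGroup.isClosedEmbedding_val.isEmbedding.tendsto_nhds_iff.trans ?_
  refine tendsto_pi_nhds.trans (forall_congr' fun i => ?_)
  exact tendsto_pi_nhds

/-! ### Matrix exponentials and one-parameter groups. -/

section Exponential

theorem Matrix.hasSum_exp {n : Type*} [DecidableEq n] [Fintype n] (A : Matrix n n ℝ) :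
    HasSum (fun k : ℕ => ((k.factorial : ℝ)⁻¹) • A ^ k) (NormedSpace.exp A) := by
  open scoped Matrix.Norms.Operator in
  exact NormedSpace.exp_series_hasSum_exp' (𝕂 := ℝ) A

/-- Intertwining passes to powers, hence to the series. A rectangular `P` allows the exponential to
be computed on an invariant subspace. -/
theorem Matrix.exp_mul_of_mul_eq {m n : Type*} [DecidableEq m] [Fintype m] [DecidableEq n]
    [Fintype n] {A : Matrix m m ℝ} {B : Matrix n n ℝ} {P : Matrix m n ℝ} (h : A * P = P * B) :
    NormedSpace.exp A * P = P * NormedSpace.exp B := by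
  have hpow : ∀ k : ℕ, A ^ k * P = P * B ^ k := by
    intro k
    induction k with
    | zero => simp
    | succ k ih => rw [pow_succ, Matrix.mul_assoc, h, ← Matrix.mul_assoc, ih, Matrix.mul_assoc,
        ← pow_succ]
  have h1 := (Matrix.hasSum_exp A).map (g := AddMonoidHom.mk' (fun M : Matrix m m ℝ => M * P)
    (fun _ _ => Matrix.add_mul _ _ _)) (by
      show Continuous fun M : Matrix m m ℝ => M * P
      fun_prop)
  have h2 := (Matrix.hasSum_exp B).map (g := AddMonoidHom.mk' (fun M : Matrix n n ℝ => P * M)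
    (fun _ _ => Matrix.mul_add _ _ _)) (by
      show Continuous fun M : Matrix n n ℝ => P * M
      fun_prop)
  refine h1.unique (h2.congr_fun fun k => ?_)
  simp [hpow]

theorem Matrix.exp_mulVec_of_mulVec_eq {n : Type*} [DecidableEq n] [Fintype n]
    {A : Matrix n n ℝ} {v : n → ℝ} {c : ℝ} (h : A.mulVec v = c • v) :
    (NormedSpace.exp A).mulVec v = Real.exp c • v := by
  have h1 : A * Matrix.of (fun i (_ : Fin 1) => v i)
      = Matrix.of (fun i (_ : Fin 1) => v i) * Matrix.diagonal fun _ : Fin 1 => c := by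
    ext i j
    rw [Matrix.mul_diagonal]
    simpa [mul_comm, Matrix.mul_apply, Matrix.mulVec, dotProduct] using congrFun h i
  ext i
  have h2 := congrFun (congrFun (Matrix.exp_mul_of_mul_eq h1) i) 0
  rw [Matrix.exp_diagonal, Matrix.mul_diagonal] at h2
  simpa [Real.exp_eq_exp_ℝ, mul_comm, Pi.coe_exp, Matrix.mul_apply, Matrix.mulVec, dotProduct]
    using h2

/-- The `2 × 2` real matrix of a complex number. -/
noncomputable def complexBlock : ℂ →+* Matrix (Fin 2) (Fin 2) ℝ where
  toFun c := !![c.re, c.im; -c.im, c.re]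
  map_one' := by ext i j; fin_cases i <;> fin_cases j <;> simp
  map_zero' := by ext i j; fin_cases i <;> fin_cases j <;> simp
  map_add' c d := by ext i j; fin_cases i <;> fin_cases j <;> simp [add_comm]
  map_mul' c d := by
    ext i j; fin_cases i <;> fin_cases j <;> simp [Matrix.mul_apply, Fin.sum_univ_two] <;> ring

theorem complexBlock_apply (c : ℂ) : complexBlock c = !![c.re, c.im; -c.im, c.re] := rfl

theorem exp_complexBlock (c : ℂ) :
    NormedSpace.exp (complexBlock c) = complexBlock (Complex.exp c) := by
  rw [Complex.exp_eq_exp_ℂ]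
  open scoped Matrix.Norms.Operator in
  refine (NormedSpace.map_exp complexBlock ?_ c).symm
  show Continuous fun c : ℂ => !![c.re, c.im; -c.im, c.re]
  refine continuous_matrix fun i j => ?_
  fin_cases i <;> fin_cases j <;> simp <;> fun_prop

variable {X : Matrix (Fin 3) (Fin 3) ℝ}

theorem exp_apply_zero_of_col (h1 : X 1 0 = 0) (h2 : X 2 0 = 0) :
    NormedSpace.exp X 0 0 = Real.exp (X 0 0) := by
  have h : X.mulVec ![1, 0, 0] = X 0 0 • ![1, 0, 0] := by
    ext i
    fin_cases i <;> simp [Matrix.mulVec, dotProduct, Fin.sum_univ_three, h1, h2]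
  simpa [Matrix.mulVec, dotProduct, Fin.sum_univ_three] using
    congrFun (Matrix.exp_mulVec_of_mulVec_eq h) 0

theorem exp_apply_two_of_row (h0 : X 2 0 = 0) (h1 : X 2 1 = 0) :
    NormedSpace.exp X 2 0 = 0 ∧ NormedSpace.exp X 2 1 = 0 ∧
      NormedSpace.exp X 2 2 = Real.exp (X 2 2) := by
  have h : X.transpose.mulVec ![0, 0, 1] = X 2 2 • ![0, 0, 1] := by
    ext i
    fin_cases i <;> simp [Matrix.mulVec, dotProduct, Fin.sum_univ_three, h0, h1]
  have := Matrix.exp_mulVec_of_mulVec_eq h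
  rw [Matrix.exp_transpose] at this
  have e0 := congrFun this 0
  have e1 := congrFun this 1
  have e2 := congrFun this 2
  simp [Matrix.mulVec, dotProduct, Fin.sum_univ_three] at e0 e1 e2
  exact ⟨e0, e1, e2⟩

theorem exp_eq_of_complexBlock (c : ℂ) (u v y : ℝ) :
    ∃ u' v' : ℝ, NormedSpace.exp !![c.re, c.im, u; -c.im, c.re, v; 0, 0, y] =
      !![(Complex.exp c).re, (Complex.exp c).im, u';
        -(Complex.exp c).im, (Complex.exp c).re, v'; 0, 0, Real.exp y] := by
  set X : Matrix (Fin 3) (Fin 3) ℝ := !![c.re, c.im, u; -c.im, c.re, v; 0, 0, y] with hX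
  -- The first two basis vectors span an invariant plane on which `X` acts as `complexBlock c`.
  have h : X * (!![1, 0; 0, 1; 0, 0] : Matrix (Fin 3) (Fin 2) ℝ)
      = (!![1, 0; 0, 1; 0, 0] : Matrix (Fin 3) (Fin 2) ℝ) * complexBlock c := by
    ext i j
    fin_cases i <;> fin_cases j <;>
      simp [hX, complexBlock_apply, Matrix.mul_apply, Fin.sum_univ_three, Fin.sum_univ_two]
  have h' := Matrix.exp_mul_of_mul_eq h
  rw [exp_complexBlock, complexBlock_apply] at h'
  have e := fun i j => congrFun (congrFun h' i) j
  obtain ⟨r0, r1, r2⟩ := exp_apply_two_of_row (X := X) (by simp [hX]) (by simp [hX])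
  refine ⟨NormedSpace.exp X 0 2, NormedSpace.exp X 1 2, ?_⟩
  have e00 := e 0 0
  have e01 := e 0 1
  have e10 := e 1 0
  have e11 := e 1 1
  simp [Matrix.mul_apply, Fin.sum_univ_three, Fin.sum_univ_two] at e00 e01 e10 e11
  ext i j
  fin_cases i <;> fin_cases j <;> simp [e00, e01, e10, e11, r0, r1, r2]
  simp [hX]

theorem exp_strictUpper (x u v : ℝ) :
    NormedSpace.exp !![0, x, u; 0, 0, v; 0, 0, 0] = !![1, x, u + x * v / 2; 0, 1, v; 0, 0, 1] := by
  set X : Matrix (Fin 3) (Fin 3) ℝ := !![0, x, u; 0, 0, v; 0, 0, 0] with hX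
  have h2 : X ^ 2 = !![0, 0, x * v; 0, 0, 0; 0, 0, 0] := by
    ext i j
    fin_cases i <;> fin_cases j <;> simp [hX, pow_two]
  have h3 : ∀ k, 3 ≤ k → X ^ k = 0 := by
    intro k hk
    obtain ⟨m, rfl⟩ := Nat.exists_eq_add_of_le hk
    have : X ^ 3 = 0 := by
      rw [pow_succ, h2]
      ext i j
      fin_cases i <;> fin_cases j <;> simp [hX]
    rw [pow_add, this, zero_mul]
  have := hasSum_sum_of_ne_finset_zero (L := SummationFilter.unconditional ℕ) (f := fun k : ℕ => ((k.factorial : ℝ)⁻¹) • X ^ k)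
    (s := Finset.range 3) (fun k hk => by
      simp only [Finset.mem_range, not_lt] at hk
      simp [h3 k hk])
  rw [(Matrix.hasSum_exp X).unique this]
  simp only [Finset.sum_range_succ, Finset.sum_range_zero, h2, pow_one, pow_zero]
  ext i j
  fin_cases i <;> fin_cases j <;> simp [hX, Nat.factorial]
  ring

open scoped Matrix.Norms.Operator in
-- Differentiation at `t = 0`: linear equations satisfied along a one-parameter group yield
-- equations for its generator.
theorem linear_eq_zero_of_exp {n : Type*} [DecidableEq n] [Fintype n] {X : Matrix n n ℝ}
    (l : Matrix n n ℝ →ₗ[ℝ] ℝ) {c : ℝ} (h : ∀ t : ℝ, l (NormedSpace.exp (t • X)) = c) :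
    l X = 0 := by
  have h1 := hasDerivAt_exp_smul_const X (0 : ℝ)
  rw [zero_smul, NormedSpace.exp_zero, one_mul] at h1
  have h2 := (LinearMap.toContinuousLinearMap l).hasFDerivAt.comp_hasDerivAt (0 : ℝ) h1
  have h3 : HasDerivAt (fun _ : ℝ => c) (l X) 0 :=
    h2.congr_of_eventuallyEq (Eventually.of_forall fun t => (h t).symm)
  exact h3.unique (hasDerivAt_const _ _)

end Exponential

/-- The map `τ` plays the role of the differential of `e`, so it identifies the two Lie algebras. -/
theorem IsClosedOfDim.of_map {n d : ℕ} {L : Subgroup (Matrix.SpecialLinearGroup (Fin n) ℝ)}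
    (e : Matrix.SpecialLinearGroup (Fin n) ℝ ≃* Matrix.SpecialLinearGroup (Fin n) ℝ)
    (he : Continuous e)
    (τ : Matrix (Fin n) (Fin n) ℝ ≃ₗ[ℝ] Matrix (Fin n) (Fin n) ℝ)
    (hτ : ∀ (A : Matrix.SpecialLinearGroup (Fin n) ℝ) (X : Matrix (Fin n) (Fin n) ℝ),
      (e A : Matrix (Fin n) (Fin n) ℝ) = NormedSpace.exp (τ X) ↔
        (A : Matrix (Fin n) (Fin n) ℝ) = NormedSpace.exp X)
    (h : IsClosedOfDim (L.map e.toMonoidHom) d) : IsClosedOfDim L d := by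
  obtain ⟨hcl, V, hV, hd⟩ := h
  refine ⟨?_, V.comap τ.toLinearMap, fun X => ?_, ?_⟩
  · convert hcl.preimage he using 1
    ext x
    simp
  · rw [Submodule.mem_comap, LinearEquiv.coe_coe, hV]
    refine forall_congr' fun t => ?_
    rw [← map_smul]
    constructor
    · rintro ⟨_, ⟨A, hA, rfl⟩, hAX⟩
      exact ⟨A, hA, (hτ A _).1 hAX⟩
    · rintro ⟨A, hA, hAX⟩
      exact ⟨e A, ⟨A, hA, rfl⟩, (hτ A _).2 hAX⟩
  · rw [← hd, Submodule.comap_equiv_eq_map_symm τ V]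
    exact LinearEquiv.finrank_map_eq τ.symm V

instance Matrix.SpecialLinearGroup.firstCountableTopology {n : Type*} [DecidableEq n] [Fintype n] :
    FirstCountableTopology (Matrix.SpecialLinearGroup n ℝ) :=
  haveI : FirstCountableTopology (Matrix n n ℝ) :=
    inferInstanceAs (FirstCountableTopology (n → n → ℝ))
  Matrix.SpecialLinearGroup.isClosedEmbedding_val.isEmbedding.isInducing.firstCountableTopology

/-- A linear function of `t` with values in the discrete group `ℤ d` vanishes: at `t = d / (2 y)` it
would take the value `d / 2`. -/
theorem eq_zero_of_forall_exists_int_mul {y d : ℝ} (h : ∀ t : ℝ, ∃ k : ℤ, t * y = k * d) :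
    y = 0 := by
  by_contra hy
  have hd : d ≠ 0 := by
    rintro rfl
    obtain ⟨k, hk⟩ := h 1
    simp [hy] at hk
  obtain ⟨k, hk⟩ := h (d / (2 * y))
  have h1 : ((2 * k : ℤ) : ℝ) = (1 : ℤ) := by
    push_cast
    field_simp at hk
    linarith
  have h2 : 2 * k = 1 := by exact_mod_cast h1
  omega

theorem SL3_det_eq_one (A : Matrix.SpecialLinearGroup (Fin 3) ℝ) :
    A 0 0 * A 1 1 * A 2 2 - A 0 0 * A 1 2 * A 2 1 - A 0 1 * A 1 0 * A 2 2
      + A 0 1 * A 1 2 * A 2 0 + A 0 2 * A 1 0 * A 2 1 - A 0 2 * A 1 1 * A 2 0 = 1 := by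
  rw [← Matrix.det_fin_three]
  exact A.det_coe

/-! ### The group `W38 z`: closedness and Lie algebra. -/

theorem mem_W38_iff {z : ℂ} {A : Matrix.SpecialLinearGroup (Fin 3) ℝ} :
    A ∈ W38 z ↔ A 2 0 = 0 ∧ A 2 1 = 0 ∧ A 1 1 = A 0 0 ∧ A 1 0 = -A 0 1 ∧
      ∃ t : ℝ, Complex.exp (z * t) = ⟨A 0 0, A 0 1⟩ ∧ Real.exp (-2 * z.re * t) = A 2 2 := by
  constructor
  · rintro ⟨t, u, v, h⟩
    rw [h]
    refine ⟨rfl, rfl, rfl, rfl, t, rfl, rfl⟩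
  · rintro ⟨h20, h21, h11, h10, t, h1, h2⟩
    refine ⟨t, A 0 2, A 1 2, ?_⟩
    have e1 := congrArg Complex.re h1
    have e2 := congrArg Complex.im h1
    simp only at e1 e2
    ext i j
    fin_cases i <;> fin_cases j <;> simp [W38Matrix, e1, e2, h20, h21, h11, h10]
    simpa using h2.symm

/-- If `z.re ≠ 0`, the corner entry determines `t` continuously, so the parameters converge. If
`z.re = 0`, they need not converge, but the blocks fill the whole unit circle and the argument of
the limit provides a parameter. -/
theorem isClosed_W38 {z : ℂ} (hz : z ≠ 0) :
    IsClosed (W38 z : Set (Matrix.SpecialLinearGroup (Fin 3) ℝ)) := by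
  refine IsSeqClosed.isClosed fun f A hf hA => ?_
  rw [Matrix.SpecialLinearGroup.tendsto_iff] at hA
  simp only [SetLike.mem_coe, mem_W38_iff] at hf ⊢
  choose h20 h21 h11 h10 t h1 h2 using hf
  have e20 : A 2 0 = 0 := tendsto_nhds_unique (hA 2 0) (by simp [h20])
  have e21 : A 2 1 = 0 := tendsto_nhds_unique (hA 2 1) (by simp [h21])
  have e11 : A 1 1 = A 0 0 := tendsto_nhds_unique (hA 1 1) (by simpa [h11] using hA 0 0)
  have e10 : A 1 0 = -A 0 1 := tendsto_nhds_unique (hA 1 0) (by simpa [h10] using (hA 0 1).neg)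
  have hdet := SL3_det_eq_one A
  rw [e20, e21, e11, e10] at hdet
  refine ⟨e20, e21, e11, e10, ?_⟩
  by_cases ha : z.re = 0
  · have hb : z.im ≠ 0 := fun hb => hz (Complex.ext ha hb)
    have e22 : A 2 2 = 1 := tendsto_nhds_unique (hA 2 2) (by simp [← h2, ha])
    have hn : ‖(⟨A 0 0, A 0 1⟩ : ℂ)‖ = 1 := by
      rw [Complex.norm_def, Complex.normSq_mk, Real.sqrt_eq_one]
      rw [e22] at hdet
      linarith
    refine ⟨Complex.arg ⟨A 0 0, A 0 1⟩ / z.im, ?_, by simp [ha, e22]⟩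
    have := Complex.norm_mul_exp_arg_mul_I ⟨A 0 0, A 0 1⟩
    rw [hn] at this
    rw [Complex.ofReal_one, one_mul] at this
    refine Eq.trans ?_ this
    have hzI : z = z.im * Complex.I := Complex.ext (by simp [ha]) (by simp)
    have hb' : (z.im : ℂ) ≠ 0 := by exact_mod_cast hb
    rw [hzI]
    congr 1
    push_cast
    simp
    field_simp
  · have hpos : 0 < A 2 2 := by
      have h0 : 0 ≤ A 2 2 := ge_of_tendsto' (hA 2 2) fun n => by
        rw [← h2]; exact (Real.exp_pos _).le
      refine lt_of_le_of_ne h0 fun h => ?_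
      rw [← h] at hdet
      simp at hdet
    have ht : Tendsto t atTop (𝓝 (Real.log (A 2 2) / (-2 * z.re))) := by
      have : t = fun n => Real.log (f n 2 2) / (-2 * z.re) := by
        ext n
        rw [← h2, Real.log_exp]
        field_simp
      rw [this]
      exact ((hA 2 2).log hpos.ne').div_const _
    refine ⟨Real.log (A 2 2) / (-2 * z.re), ?_, ?_⟩
    · have hl : Tendsto (fun n => Complex.exp (z * t n)) atTop
          (𝓝 (Complex.exp (z * (Real.log (A 2 2) / (-2 * z.re) : ℝ)))) := by
        refine Tendsto.cexp (Tendsto.const_mul _ ?_)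
        exact (Complex.continuous_ofReal.tendsto _).comp ht
      refine Complex.ext ?_ ?_
      · refine tendsto_nhds_unique ((Complex.continuous_re.tendsto _).comp hl) ?_
        simpa [Function.comp_def, h1] using hA 0 0
      · refine tendsto_nhds_unique ((Complex.continuous_im.tendsto _).comp hl) ?_
        simpa [Function.comp_def, h1] using hA 0 1
    · rw [mul_div_cancel₀ _ (by simpa using ha), Real.exp_log hpos]

/-- The parametrization of the Lie algebra of `W38 z`. -/
noncomputable def W38LieParam (z : ℂ) : (Fin 3 → ℝ) →ₗ[ℝ] Matrix (Fin 3) (Fin 3) ℝ where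
  toFun f := !![(z * f 0).re, (z * f 0).im, f 1; -(z * f 0).im, (z * f 0).re, f 2;
    0, 0, -2 * z.re * f 0]
  map_add' f g := by
    ext i j
    fin_cases i <;> fin_cases j <;> simp <;> ring
  map_smul' c f := by
    ext i j
    fin_cases i <;> fin_cases j <;> simp <;> ring

theorem W38LieParam_apply (z : ℂ) (f : Fin 3 → ℝ) : W38LieParam z f =
    !![(z * f 0).re, (z * f 0).im, f 1; -(z * f 0).im, (z * f 0).re, f 2;
      0, 0, -2 * z.re * f 0] := rfl

theorem W38LieParam_injective {z : ℂ} (hz : z ≠ 0) : Function.Injective (W38LieParam z) := by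
  rw [injective_iff_map_eq_zero]
  intro f hf
  rw [W38LieParam_apply] at hf
  have e := fun i j => congrFun (congrFun hf i) j
  have h00 := e 0 0
  have h01 := e 0 1
  have h02 := e 0 2
  have h12 := e 1 2
  simp at h00 h01 h02 h12
  have h0 : f 0 = 0 := by
    by_contra h
    simp only [h, or_false] at h00 h01
    exact hz (Complex.ext h00 h01)
  ext i
  fin_cases i <;> simp [h0, h02, h12]

theorem det_W38Matrix (z : ℂ) (t u v : ℝ) : (W38Matrix z t u v).det = 1 := by
  rw [W38Matrix, Matrix.det_fin_three]
  have h1 : (Complex.exp (z * t)).re ^ 2 + (Complex.exp (z * t)).im ^ 2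
      = Real.exp (2 * (z.re * t)) := by
    rw [Complex.exp_re, Complex.exp_im, mul_pow, mul_pow, ← mul_add, Real.cos_sq_add_sin_sq,
      mul_one, ← Real.exp_nat_mul]
    simp
  have h2 : Real.exp (2 * (z.re * t)) * Real.exp (-2 * z.re * t) = 1 := by
    rw [← Real.exp_add]; ring_nf; simp
  rw [← h1] at h2
  simp only [Matrix.of_apply, Matrix.cons_val]
  linear_combination h2

theorem exists_mem_W38_eq_exp (z : ℂ) (f : Fin 3 → ℝ) :
    ∃ A ∈ W38 z, (A : Matrix (Fin 3) (Fin 3) ℝ) = NormedSpace.exp (W38LieParam z f) := by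
  obtain ⟨u, v, h⟩ := exp_eq_of_complexBlock (z * f 0) (f 1) (f 2) (-2 * z.re * f 0)
  exact ⟨⟨_, det_W38Matrix z (f 0) u v⟩, ⟨f 0, u, v, rfl⟩, h.symm⟩

/-- The linear functional reading off an entry of a matrix. -/
noncomputable abbrev entryFunctional (i j : Fin 3) : Matrix (Fin 3) (Fin 3) ℝ →ₗ[ℝ] ℝ :=
  Matrix.entryLinearMap ℝ ℝ i j

theorem mem_range_W38LieParam {z : ℂ} (hz : z ≠ 0) {X : Matrix (Fin 3) (Fin 3) ℝ}
    (hX : ∀ t : ℝ, ∃ A ∈ W38 z, (A : Matrix (Fin 3) (Fin 3) ℝ) = NormedSpace.exp (t • X)) :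
    X ∈ LinearMap.range (W38LieParam z) := by
  have key : ∀ t : ℝ, ∃ τ u v, NormedSpace.exp (t • X) = W38Matrix z τ u v := by
    intro t
    obtain ⟨A, ⟨τ, u, v, hA⟩, h⟩ := hX t
    exact ⟨τ, u, v, h ▸ hA⟩
  have h20 : X 2 0 = 0 := linear_eq_zero_of_exp (entryFunctional 2 0) (c := 0) fun t => by
    obtain ⟨τ, u, v, h⟩ := key t
    simp [h, W38Matrix]
  have h21 : X 2 1 = 0 := linear_eq_zero_of_exp (entryFunctional 2 1) (c := 0) fun t => by
    obtain ⟨τ, u, v, h⟩ := key t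
    simp [h, W38Matrix]
  have h11 : X 1 1 - X 0 0 = 0 :=
    linear_eq_zero_of_exp (entryFunctional 1 1 - entryFunctional 0 0) (c := 0) fun t => by
      obtain ⟨τ, u, v, h⟩ := key t
      simp [h, W38Matrix]
  have h10 : X 1 0 + X 0 1 = 0 :=
    linear_eq_zero_of_exp (entryFunctional 1 0 + entryFunctional 0 1) (c := 0) fun t => by
      obtain ⟨τ, u, v, h⟩ := key t
      simp [h, W38Matrix]
  set c : ℂ := ⟨X 0 0, X 0 1⟩ with hc
  have hXc : ∀ t : ℝ, t • X = !![(c * t).re, (c * t).im, t * X 0 2;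
      -(c * t).im, (c * t).re, t * X 1 2; 0, 0, t * X 2 2] := by
    intro t
    ext i j
    fin_cases i <;> fin_cases j <;> simp [hc, h20, h21, sub_eq_zero.1 h11,
      eq_neg_of_add_eq_zero_left h10, mul_comm]
  have hτ : ∀ t : ℝ, ∃ τ : ℝ, Complex.exp (c * t) = Complex.exp (z * τ) ∧
      t * X 2 2 = -2 * z.re * τ := by
    intro t
    obtain ⟨u, v, h⟩ := exp_eq_of_complexBlock (c * t) (t * X 0 2) (t * X 1 2) (t * X 2 2)
    obtain ⟨τ, u', v', h'⟩ := key t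
    rw [← hXc, h'] at h
    have e := fun i j => congrFun (congrFun h i) j
    have e00 := e 0 0
    have e01 := e 0 1
    have e22 := e 2 2
    simp only [W38Matrix, Matrix.of_apply, Matrix.cons_val] at e00 e01 e22
    exact ⟨τ, Complex.ext e00.symm e01.symm, Real.exp_injective e22.symm⟩
  have hre : ∀ t τ : ℝ, Complex.exp (c * t) = Complex.exp (z * τ) → c.re * t = z.re * τ := by
    intro t τ h
    have := congrArg norm h
    rw [Complex.norm_exp, Complex.norm_exp] at this
    simpa using Real.exp_injective this
  -- Moduli determine `τ` as a linear function of `t` when `z.re ≠ 0`; the imaginary parts then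
  -- differ by a linear function of `t` with values in `2πℤ`, which must vanish. When `z.re = 0`,
  -- moduli force `c` to be imaginary.
  obtain ⟨s, hs⟩ : ∃ s : ℝ, c = z * s := by
    by_cases ha : z.re = 0
    · have hb : z.im ≠ 0 := fun hb => hz (Complex.ext ha hb)
      refine ⟨c.im / z.im, Complex.ext ?_ ?_⟩
      · obtain ⟨τ, h, -⟩ := hτ 1
        have := hre _ _ h
        simp only [ha] at this
        simpa [ha] using this
      · simp [hb, mul_div_cancel₀]
    · refine ⟨c.re / z.re, Complex.ext (by simp [ha, mul_div_cancel₀]) ?_⟩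
      have : c.im - z.im * (c.re / z.re) = 0 := by
        refine eq_zero_of_forall_exists_int_mul (d := 2 * Real.pi) fun t => ?_
        obtain ⟨τ, h, -⟩ := hτ t
        have h1 := hre _ _ h
        obtain ⟨k, hk⟩ := Complex.exp_eq_exp_iff_exists_int.1 h
        refine ⟨k, ?_⟩
        have h2 := congrArg Complex.im hk
        simp at h2
        have h3 : τ = c.re * t / z.re := by field_simp; linarith
        rw [h3] at h2
        linear_combination h2
      simpa using sub_eq_zero.1 this
  have hy : X 2 2 = -2 * z.re * s := by
    obtain ⟨τ, h, h2⟩ := hτ 1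
    have h1 := hre _ _ h
    have h3 := congrArg Complex.re hs
    simp at h1 h2 h3
    linear_combination h2 - 2 * h3 + 2 * h1
  refine ⟨![s, X 0 2, X 1 2], ?_⟩
  have h1 := hXc 1
  rw [one_smul] at h1
  rw [W38LieParam_apply, h1]
  simp only [Matrix.cons_val, ← hs, hy]
  simp

theorem isClosedOfDim_W38 {z : ℂ} (hz : z ≠ 0) : IsClosedOfDim (W38 z) 3 := by
  refine ⟨isClosed_W38 hz, LinearMap.range (W38LieParam z), fun X => ⟨?_,
    mem_range_W38LieParam hz⟩, ?_⟩
  · rintro ⟨f, rfl⟩ t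
    rw [← map_smul]
    exact exists_mem_W38_eq_exp z _
  · rw [LinearMap.finrank_range_of_inj (W38LieParam_injective hz)]
    simp

/-! ### Invariance of dimension under conjugation. -/

section Conjugation

theorem Matrix.SpecialLinearGroup.exp_conj {n : ℕ}
    (g : Matrix.SpecialLinearGroup (Fin n) ℝ) (X : Matrix (Fin n) (Fin n) ℝ) :
    NormedSpace.exp ((g : Matrix (Fin n) (Fin n) ℝ) * X *
        ((g⁻¹ : Matrix.SpecialLinearGroup (Fin n) ℝ) : Matrix (Fin n) (Fin n) ℝ)) =
      (g : Matrix (Fin n) (Fin n) ℝ) * NormedSpace.exp X *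
        ((g⁻¹ : Matrix.SpecialLinearGroup (Fin n) ℝ) : Matrix (Fin n) (Fin n) ℝ) := by
  have h1 : (g : Matrix (Fin n) (Fin n) ℝ) *
      ((g⁻¹ : Matrix.SpecialLinearGroup (Fin n) ℝ) : Matrix (Fin n) (Fin n) ℝ) = 1 := by
    rw [← Matrix.SpecialLinearGroup.coe_mul, mul_inv_cancel, Matrix.SpecialLinearGroup.coe_one]
  rw [← Matrix.inv_eq_right_inv h1]
  refine Matrix.exp_conj _ _ ?_
  rw [Matrix.isUnit_iff_isUnit_det, g.det_coe]
  exact isUnit_one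

theorem Matrix.SpecialLinearGroup.coe_mul_coe_inv {n : ℕ}
    (g : Matrix.SpecialLinearGroup (Fin n) ℝ) : (g : Matrix (Fin n) (Fin n) ℝ) *
      ((g⁻¹ : Matrix.SpecialLinearGroup (Fin n) ℝ) : Matrix (Fin n) (Fin n) ℝ) = 1 := by
  rw [← Matrix.SpecialLinearGroup.coe_mul, mul_inv_cancel, Matrix.SpecialLinearGroup.coe_one]

theorem Matrix.SpecialLinearGroup.coe_inv_mul_coe {n : ℕ}
    (g : Matrix.SpecialLinearGroup (Fin n) ℝ) :
    ((g⁻¹ : Matrix.SpecialLinearGroup (Fin n) ℝ) : Matrix (Fin n) (Fin n) ℝ) *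
      (g : Matrix (Fin n) (Fin n) ℝ) = 1 := by
  rw [← Matrix.SpecialLinearGroup.coe_mul, inv_mul_cancel, Matrix.SpecialLinearGroup.coe_one]

/-- Conjugation by an element of `SL(n, ℝ)` as a linear automorphism of the space of matrices. -/
noncomputable def conjLinearEquiv {n : ℕ} (g : Matrix.SpecialLinearGroup (Fin n) ℝ) :
    Matrix (Fin n) (Fin n) ℝ ≃ₗ[ℝ] Matrix (Fin n) (Fin n) ℝ where
  toFun X := (g : Matrix (Fin n) (Fin n) ℝ) * X *
    ((g⁻¹ : Matrix.SpecialLinearGroup (Fin n) ℝ) : Matrix (Fin n) (Fin n) ℝ)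
  invFun X := ((g⁻¹ : Matrix.SpecialLinearGroup (Fin n) ℝ) : Matrix (Fin n) (Fin n) ℝ) * X *
    (g : Matrix (Fin n) (Fin n) ℝ)
  map_add' X Y := by rw [mul_add, add_mul]
  map_smul' c X := by simp
  left_inv X := by
    simp only [← mul_assoc, g.coe_inv_mul_coe, one_mul]
    rw [mul_assoc, g.coe_inv_mul_coe, mul_one]
  right_inv X := by
    simp only [← mul_assoc, g.coe_mul_coe_inv, one_mul]
    rw [mul_assoc, g.coe_mul_coe_inv, mul_one]

theorem IsClosedOfDim.of_map_conj {n d : ℕ} {L : Subgroup (Matrix.SpecialLinearGroup (Fin n) ℝ)}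
    (g : Matrix.SpecialLinearGroup (Fin n) ℝ)
    (h : IsClosedOfDim (L.map (MulAut.conj g).toMonoidHom) d) : IsClosedOfDim L d := by
  refine h.of_map (MulAut.conj g) ?_ (conjLinearEquiv g) fun A X => ?_
  · show Continuous fun A => g * A * g⁻¹
    fun_prop
  · show ((g * A * g⁻¹ : Matrix.SpecialLinearGroup (Fin n) ℝ) : Matrix (Fin n) (Fin n) ℝ) =
      NormedSpace.exp ((g : Matrix (Fin n) (Fin n) ℝ) * X *
        ((g⁻¹ : Matrix.SpecialLinearGroup (Fin n) ℝ) : Matrix (Fin n) (Fin n) ℝ)) ↔ _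
    rw [g.exp_conj, Matrix.SpecialLinearGroup.coe_mul, Matrix.SpecialLinearGroup.coe_mul]
    exact (conjLinearEquiv g).injective.eq_iff

end Conjugation

/-! ### The duality exchanging the two families. -/

section Duality

/-- Transposition followed by reversal of the order of the basis. -/
noncomputable def reverseTranspose : Matrix (Fin 3) (Fin 3) ℝ ≃ₗ[ℝ] Matrix (Fin 3) (Fin 3) ℝ :=
  (Matrix.transposeLinearEquiv (Fin 3) (Fin 3) ℝ ℝ).trans
    (Matrix.reindexAlgEquiv ℝ ℝ Fin.revPerm).toLinearEquiv

theorem reverseTranspose_apply (X : Matrix (Fin 3) (Fin 3) ℝ) (i j : Fin 3) :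
    reverseTranspose X i j = X j.rev i.rev := rfl

theorem reverseTranspose_eq (X : Matrix (Fin 3) (Fin 3) ℝ) :
    reverseTranspose X = Matrix.reindexAlgEquiv ℝ ℝ Fin.revPerm X.transpose := rfl

theorem reverseTranspose_mul (X Y : Matrix (Fin 3) (Fin 3) ℝ) :
    reverseTranspose (X * Y) = reverseTranspose Y * reverseTranspose X := by
  rw [reverseTranspose_eq, Matrix.transpose_mul, map_mul]
  rfl

theorem reverseTranspose_involutive : Function.Involutive reverseTranspose := fun X => by
  ext i j
  simp [reverseTranspose_apply]

theorem exp_reverseTranspose (X : Matrix (Fin 3) (Fin 3) ℝ) :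
    NormedSpace.exp (reverseTranspose X) = reverseTranspose (NormedSpace.exp X) := by
  rw [reverseTranspose_eq, reverseTranspose_eq, ← Matrix.exp_transpose]
  open scoped Matrix.Norms.Operator in
  refine (NormedSpace.map_exp (Matrix.reindexAlgEquiv ℝ ℝ Fin.revPerm) ?_ X.transpose).symm
  show Continuous fun M : Matrix (Fin 3) (Fin 3) ℝ => M.submatrix _ _
  fun_prop

/-- `reverseTranspose` as an operation on `SL(3, ℝ)`. -/
noncomputable def reverseTransposeSL (A : Matrix.SpecialLinearGroup (Fin 3) ℝ) :
    Matrix.SpecialLinearGroup (Fin 3) ℝ :=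
  ⟨reverseTranspose A, by
    rw [reverseTranspose_eq, Matrix.coe_reindexAlgEquiv, Matrix.det_reindex_self,
      Matrix.det_transpose, A.det_coe]⟩

theorem coe_reverseTransposeSL (A : Matrix.SpecialLinearGroup (Fin 3) ℝ) :
    (reverseTransposeSL A : Matrix (Fin 3) (Fin 3) ℝ) = reverseTranspose A := rfl

theorem reverseTransposeSL_mul (A B : Matrix.SpecialLinearGroup (Fin 3) ℝ) :
    reverseTransposeSL (A * B) = reverseTransposeSL B * reverseTransposeSL A :=
  Subtype.ext (reverseTranspose_mul _ _)

theorem reverseTransposeSL_involutive : Function.Involutive reverseTransposeSL := fun _ =>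
  Subtype.ext (reverseTranspose_involutive _)

theorem reverseTransposeSL_one : reverseTransposeSL 1 = 1 := by
  have h := reverseTransposeSL_mul 1 1
  rw [mul_one] at h
  exact left_eq_mul.1 h

theorem reverseTransposeSL_inv (A : Matrix.SpecialLinearGroup (Fin 3) ℝ) :
    reverseTransposeSL A⁻¹ = (reverseTransposeSL A)⁻¹ := by
  rw [eq_inv_iff_mul_eq_one, ← reverseTransposeSL_mul, mul_inv_cancel, reverseTransposeSL_one]

/-- The automorphism of `SL(3, ℝ)` that inverts, transposes and reverses the order of the basis. -/
noncomputable def dualAut :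
    Matrix.SpecialLinearGroup (Fin 3) ℝ ≃* Matrix.SpecialLinearGroup (Fin 3) ℝ where
  toFun A := reverseTransposeSL A⁻¹
  invFun A := reverseTransposeSL A⁻¹
  left_inv A := by
    show reverseTransposeSL (reverseTransposeSL A⁻¹)⁻¹ = A
    rw [← reverseTransposeSL_inv, inv_inv]
    exact reverseTransposeSL_involutive A
  right_inv A := by
    show reverseTransposeSL (reverseTransposeSL A⁻¹)⁻¹ = A
    rw [← reverseTransposeSL_inv, inv_inv]
    exact reverseTransposeSL_involutive A
  map_mul' A B := by rw [mul_inv_rev, reverseTransposeSL_mul]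

theorem dualAut_apply (A : Matrix.SpecialLinearGroup (Fin 3) ℝ) :
    dualAut A = reverseTransposeSL A⁻¹ := rfl

theorem continuous_dualAut : Continuous dualAut := by
  refine Continuous.comp (g := reverseTransposeSL) ?_ continuous_inv
  refine Matrix.SpecialLinearGroup.isClosedEmbedding_val.isEmbedding.continuous_iff.2 ?_
  refine continuous_matrix fun i j => ?_
  exact (Matrix.SpecialLinearGroup.isClosedEmbedding_val.continuous).matrix_elem _ _

/-- The differential of `dualAut` is `X ↦ -reverseTranspose X`, the sign coming from the inversion.
-/
theorem IsClosedOfDim.of_map_dualAut {d : ℕ}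
    {L : Subgroup (Matrix.SpecialLinearGroup (Fin 3) ℝ)}
    (h : IsClosedOfDim (L.map dualAut.toMonoidHom) d) : IsClosedOfDim L d := by
  refine h.of_map dualAut continuous_dualAut
    (reverseTranspose.trans (LinearEquiv.neg ℝ)) fun A X => ?_
  rw [LinearEquiv.trans_apply, LinearEquiv.neg_apply, ← map_neg, exp_reverseTranspose,
    dualAut_apply, coe_reverseTransposeSL, reverseTranspose.injective.eq_iff]
  have hX : NormedSpace.exp (-X) * NormedSpace.exp X = 1 := by
    rw [← Matrix.exp_add_of_commute _ _ (Commute.neg_left (Commute.refl X)), neg_add_cancel,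
      NormedSpace.exp_zero]
  constructor
  · intro hA
    rw [← hA] at hX
    exact left_inv_eq_right_inv A.coe_mul_coe_inv hX
  · intro hA
    rw [← hA] at hX
    exact (left_inv_eq_right_inv hX A.coe_mul_coe_inv).symm

/-- Reflection in the antidiagonal preserves the orientation of the complex block and swaps the two
entries of the vector. The inversion costs nothing, since both sides are subgroups. -/
theorem map_dualAut_W39 (z : ℂ) : (W39 z).map dualAut.toMonoidHom = W38 z := by
  ext A
  constructor
  · rintro ⟨B, hB, rfl⟩
    obtain ⟨t, u, v, h⟩ := inv_mem hB
    refine ⟨t, v, u, ?_⟩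
    show reverseTranspose _ = _
    rw [h]
    ext i j
    fin_cases i <;> fin_cases j <;> rfl
  · intro hA
    refine ⟨dualAut A, ?_, dualAut.apply_symm_apply A⟩
    obtain ⟨t, u, v, h⟩ := inv_mem hA
    refine ⟨t, v, u, ?_⟩
    show reverseTranspose _ = _
    rw [h]
    ext i j
    fin_cases i <;> fin_cases j <;> rfl

end Duality

/-! ### Stretches, and elements normalizing `W38 z`. -/

/-- The diagonal matrix with entries `s`, `s⁻¹`, `1`. -/
noncomputable def stretch (s : ℝ) (hs : s ≠ 0) : Matrix.SpecialLinearGroup (Fin 3) ℝ :=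
  ⟨!![s, 0, 0; 0, s⁻¹, 0; 0, 0, 1], by simp [Matrix.det_fin_three, hs]⟩

theorem stretch_inv (s : ℝ) (hs : s ≠ 0) :
    ((stretch s hs)⁻¹ : Matrix.SpecialLinearGroup (Fin 3) ℝ) = stretch s⁻¹ (inv_ne_zero hs) := by
  rw [inv_eq_iff_mul_eq_one]
  ext i j
  rw [Matrix.SpecialLinearGroup.coe_mul]
  fin_cases i <;> fin_cases j <;>
    simp [stretch, Matrix.mul_apply, Fin.sum_univ_three, hs]

theorem mem_normalizer_of_forall {G : Type*} [Group G] {H : Subgroup G} {n : G}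
    (h : ∀ x ∈ H, n * x * n⁻¹ ∈ H) (h' : ∀ x ∈ H, n⁻¹ * x * n ∈ H) :
    n ∈ Subgroup.normalizer (H : Set G) := by
  refine Subgroup.mem_normalizer_iff.2 fun x => ⟨h x, fun hx => ?_⟩
  simpa [mul_assoc] using h' _ hx

/-- Complex blocks commute, so conjugation by `n` leaves block and corner of `A` unchanged and
alters only the unconstrained column. The inverse is written as the adjugate, and `hdet` removes the
resulting factor. -/
theorem conj_mem_W38 {z : ℂ} {n A : Matrix.SpecialLinearGroup (Fin 3) ℝ}
    (h20 : n 2 0 = 0) (h21 : n 2 1 = 0) (h11 : n 1 1 = n 0 0) (h10 : n 1 0 = -n 0 1)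
    (hA : A ∈ W38 z) : n * A * n⁻¹ ∈ W38 z := by
  obtain ⟨a20, a21, a11, a10, t, h1, h2⟩ := mem_W38_iff.1 hA
  have hdet := SL3_det_eq_one n
  rw [h20, h21, h11, h10] at hdet
  have e : ∀ i j, (n * A * n⁻¹) i j = ∑ k, (∑ l, n i l * A l k) *
      (n : Matrix (Fin 3) (Fin 3) ℝ).adjugate k j := fun i j => by
    rw [Matrix.SpecialLinearGroup.coe_mul, Matrix.SpecialLinearGroup.coe_mul,
      Matrix.SpecialLinearGroup.coe_inv]
    simp only [Matrix.mul_apply]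
  simp only [Fin.sum_univ_three, Matrix.adjugate_fin_three, Matrix.of_apply, Matrix.cons_val] at e
  rw [mem_W38_iff]
  refine ⟨?_, ?_, ?_, ?_, t, ?_, ?_⟩
  · rw [e]; simp [h20, h21, a20, a21]
  · rw [e]; simp [h20, h21, a20, a21]
  · simp [e, h20, h21, h11, h10, a20, a21, a11, a10]; ring
  · simp [e, h20, h21, h11, h10, a20, a21, a11, a10]; ring
  · rw [h1]
    refine Complex.ext ?_ ?_
    · simp [e, h20, h21, h11, h10, a20, a21, a11, a10]
      linear_combination -(A 0 0) * hdet
    · simp [e, h20, h21, h11, h10, a20, a21, a11, a10]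
      linear_combination -(A 0 1) * hdet
  · rw [h2]
    simp [e, h20, h21, h11, h10, a20, a21, a11, a10]
    linear_combination -(A 2 2) * hdet

theorem mem_normalizer_W38 {z : ℂ} {n : Matrix.SpecialLinearGroup (Fin 3) ℝ}
    (h20 : n 2 0 = 0) (h21 : n 2 1 = 0) (h11 : n 1 1 = n 0 0) (h10 : n 1 0 = -n 0 1) :
    n ∈ Subgroup.normalizer (W38 z : Set (Matrix.SpecialLinearGroup (Fin 3) ℝ)) := by
  refine mem_normalizer_of_forall (fun A hA => conj_mem_W38 h20 h21 h11 h10 hA) fun A hA => ?_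
  have := conj_mem_W38 (n := n⁻¹) (z := z) (A := A)
    (by simp [Matrix.SpecialLinearGroup.coe_inv, Matrix.adjugate_fin_three, h20, h21])
    (by simp [Matrix.SpecialLinearGroup.coe_inv, Matrix.adjugate_fin_three, h20, h21])
    (by simp [Matrix.SpecialLinearGroup.coe_inv, Matrix.adjugate_fin_three, h20, h21, h11])
    (by simp [Matrix.SpecialLinearGroup.coe_inv, Matrix.adjugate_fin_three, h20, h21, h10]) hA
  rwa [inv_inv] at this

theorem stretch_conj_apply (s : ℝ) (hs : s ≠ 0) (A : Matrix.SpecialLinearGroup (Fin 3) ℝ) :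
    ((stretch s hs * A * (stretch s hs)⁻¹ : Matrix.SpecialLinearGroup (Fin 3) ℝ) :
      Matrix (Fin 3) (Fin 3) ℝ) = !![A 0 0, s ^ 2 * A 0 1, s * A 0 2;
        s⁻¹ ^ 2 * A 1 0, A 1 1, s⁻¹ * A 1 2; s⁻¹ * A 2 0, s * A 2 1, A 2 2] := by
  rw [stretch_inv, Matrix.SpecialLinearGroup.coe_mul, Matrix.SpecialLinearGroup.coe_mul]
  ext i j
  simp only [stretch, Matrix.mul_apply, Fin.sum_univ_three]
  fin_cases i <;> fin_cases j <;> simp <;> field_simp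

/-- For real `z` the block is scalar, so the stretch commutes with it. -/
theorem stretch_conj_mem_W38 {z : ℂ} (hz : z.im = 0) {s : ℝ} (hs : s ≠ 0)
    {A : Matrix.SpecialLinearGroup (Fin 3) ℝ} (hA : A ∈ W38 z) :
    stretch s hs * A * (stretch s hs)⁻¹ ∈ W38 z := by
  obtain ⟨a20, a21, a11, a10, t, h1, h2⟩ := mem_W38_iff.1 hA
  have a01 : A 0 1 = 0 := by
    have := congrArg Complex.im h1
    rw [Complex.exp_im] at this
    simpa [hz] using this.symm
  rw [mem_W38_iff, stretch_conj_apply]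
  refine ⟨?_, ?_, ?_, ?_, t, ?_, ?_⟩ <;> simp [a20, a21, a11, a10, a01, h1, ← h2]

theorem stretch_mem_normalizer_W38 {z : ℂ} (hz : z.im = 0) (s : ℝ) (hs : s ≠ 0) :
    stretch s hs ∈ Subgroup.normalizer (W38 z : Set (Matrix.SpecialLinearGroup (Fin 3) ℝ)) := by
  refine mem_normalizer_of_forall (fun A hA => stretch_conj_mem_W38 hz hs hA) fun A hA => ?_
  have := stretch_conj_mem_W38 hz (inv_ne_zero hs) hA
  rwa [← stretch_inv, inv_inv] at this

/-! ### Factorization into bounded, stretching and normalizing parts. -/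

section Decomposition

theorem isCompact_entries_le_one :
    IsCompact {A : Matrix.SpecialLinearGroup (Fin 3) ℝ | ∀ i j, |A i j| ≤ 1} := by
  have h : IsCompact (Set.univ.pi fun _ : Fin 3 => Set.univ.pi fun _ : Fin 3 =>
      Set.Icc (-1 : ℝ) 1) :=
    isCompact_univ_pi fun _ => isCompact_univ_pi fun _ => isCompact_Icc
  refine Eq.subst (motive := IsCompact) (Set.ext fun A => ?_)
    (Matrix.SpecialLinearGroup.isClosedEmbedding_val.isCompact_preimage h)
  simp only [Set.mem_ofPred_eq, abs_le]
  exact ⟨fun h i j => h i trivial j trivial, fun h i _ j _ => h i j⟩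

/-- Principal axes of the quadratic form with matrix `!![a, c; c, b]`: the off-diagonal term goes
from `c` to `-c` over a quarter turn, so it vanishes at some angle. A further quarter turn exchanges
the axes if they come in the wrong order. -/
theorem exists_rotation_orthogonal (a b c : ℝ) :
    ∃ x y : ℝ, x ^ 2 + y ^ 2 = 1 ∧ x * y * (b - a) + c * (x ^ 2 - y ^ 2) = 0 ∧
      x ^ 2 * b - 2 * x * y * c + y ^ 2 * a ≤ x ^ 2 * a + 2 * x * y * c + y ^ 2 * b := by
  let F : ℝ → ℝ := fun θ =>
    Real.cos θ * Real.sin θ * (b - a) + c * (Real.cos θ ^ 2 - Real.sin θ ^ 2)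
  have hF : Continuous F := by fun_prop
  obtain ⟨θ, hθ⟩ : ∃ θ, F θ = 0 := by
    have h0 : F 0 = c := by simp [F]
    have h1 : F (Real.pi / 2) = -c := by simp [F]
    refine mem_range_of_exists_le_of_exists_ge hF ?_ ?_
    · rcases le_total c 0 with h | h
      · exact ⟨0, h0.trans_le h⟩
      · exact ⟨Real.pi / 2, by rw [h1]; linarith⟩
    · rcases le_total c 0 with h | h
      · exact ⟨Real.pi / 2, by rw [h1]; linarith⟩
      · exact ⟨0, h.trans_eq h0.symm⟩
  have hsq := Real.cos_sq_add_sin_sq θ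
  rcases le_total
    (Real.cos θ ^ 2 * b - 2 * Real.cos θ * Real.sin θ * c + Real.sin θ ^ 2 * a)
    (Real.cos θ ^ 2 * a + 2 * Real.cos θ * Real.sin θ * c + Real.sin θ ^ 2 * b) with h | h
  · exact ⟨Real.cos θ, Real.sin θ, hsq, hθ, h⟩
  · refine ⟨-Real.sin θ, Real.cos θ, by linarith, ?_, by linarith⟩
    simp only [F] at hθ
    linear_combination -hθ

/-- The third column is the cross product, a unit vector by Lagrange's identity. -/
theorem exists_special_orthogonal_of_frame {u v : Fin 3 → ℝ}
    (hu : u 0 ^ 2 + u 1 ^ 2 + u 2 ^ 2 = 1) (hv : v 0 ^ 2 + v 1 ^ 2 + v 2 ^ 2 = 1)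
    (huv : u 0 * v 0 + u 1 * v 1 + u 2 * v 2 = 0) :
    ∃ k : Matrix.SpecialLinearGroup (Fin 3) ℝ,
      (∀ i, k i 0 = u i) ∧ (∀ i, k i 1 = v i) ∧ ∀ i j, |k i j| ≤ 1 := by
  have hw : (u 1 * v 2 - u 2 * v 1) ^ 2 + (u 2 * v 0 - u 0 * v 2) ^ 2
      + (u 0 * v 1 - u 1 * v 0) ^ 2 = 1 := by
    linear_combination (v 0 ^ 2 + v 1 ^ 2 + v 2 ^ 2) * hu + hv
      - (u 0 * v 0 + u 1 * v 1 + u 2 * v 2) * huv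
  refine ⟨⟨!![u 0, v 0, u 1 * v 2 - u 2 * v 1; u 1, v 1, u 2 * v 0 - u 0 * v 2;
    u 2, v 2, u 0 * v 1 - u 1 * v 0], ?_⟩, ?_, ?_, ?_⟩
  · rw [Matrix.det_fin_three]
    simp only [Matrix.of_apply, Matrix.cons_val]
    linear_combination hw
  · intro i; fin_cases i <;> rfl
  · intro i; fin_cases i <;> rfl
  · intro i j
    rw [← sq_le_one_iff_abs_le_one]
    fin_cases i <;> fin_cases j <;> simp only [Fin.zero_eta, Fin.mk_one, Fin.reduceFinMk,
      Matrix.of_apply, Matrix.cons_val] <;> first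
      | linarith [sq_nonneg (u 0), sq_nonneg (u 1), sq_nonneg (u 2)]
      | linarith [sq_nonneg (v 0), sq_nonneg (v 1), sq_nonneg (v 2)]
      | linarith [sq_nonneg (u 1 * v 2 - u 2 * v 1), sq_nonneg (u 2 * v 0 - u 0 * v 2),
          sq_nonneg (u 0 * v 1 - u 1 * v 0)]

theorem sum_three_sq_pos {f : Fin 3 → ℝ} (hf : f ≠ 0) : 0 < f 0 ^ 2 + f 1 ^ 2 + f 2 ^ 2 := by
  refine lt_of_le_of_ne (by positivity) fun h => hf ?_
  ext i
  refine (pow_eq_zero_iff two_ne_zero).1 (le_antisymm ?_ (sq_nonneg _))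
  fin_cases i <;> simp only [Fin.zero_eta, Fin.mk_one, Fin.reduceFinMk] <;>
    linarith [sq_nonneg (f 0), sq_nonneg (f 1), sq_nonneg (f 2)]

/-- A singular value decomposition of the first two columns of `p`: a rotation makes them orthogonal
vectors `f`, `g` of lengths `α ≥ β`. The stretch accounts for the ratio `α / β = s ^ 2`, and the
geometric mean `s * β` of the lengths, together with the rotation, forms the complex block of `n`.
The last column of `n` is unconstrained and absorbs the rest. -/
theorem exists_compact_mul_stretch_mul_normalizer (p : Matrix.SpecialLinearGroup (Fin 3) ℝ) :
    ∃ (k : Matrix.SpecialLinearGroup (Fin 3) ℝ) (s : ℝ) (hs : s ≠ 0)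
      (n : Matrix.SpecialLinearGroup (Fin 3) ℝ),
      p = k * stretch s hs * n ∧ (∀ i j, |k i j| ≤ 1) ∧ 1 ≤ s ∧
      n 2 0 = 0 ∧ n 2 1 = 0 ∧ n 1 1 = n 0 0 ∧ n 1 0 = -n 0 1 := by
  obtain ⟨x, y, hxy, horth, hle⟩ := exists_rotation_orthogonal
    (p 0 0 ^ 2 + p 1 0 ^ 2 + p 2 0 ^ 2) (p 0 1 ^ 2 + p 1 1 ^ 2 + p 2 1 ^ 2)
    (p 0 0 * p 0 1 + p 1 0 * p 1 1 + p 2 0 * p 2 1)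
  have hdet := SL3_det_eq_one p
  obtain ⟨f, hf⟩ : ∃ f : Fin 3 → ℝ, ∀ i, f i = x * p i 0 + y * p i 1 := ⟨_, fun _ => rfl⟩
  obtain ⟨g, hg⟩ : ∃ g : Fin 3 → ℝ, ∀ i, g i = -y * p i 0 + x * p i 1 := ⟨_, fun _ => rfl⟩
  have hp0 : ∀ i, p i 0 = x * f i - y * g i := fun i => by
    rw [hf, hg]; linear_combination -(p i 0) * hxy
  have hp1 : ∀ i, p i 1 = y * f i + x * g i := fun i => by
    rw [hf, hg]; linear_combination -(p i 1) * hxy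
  have hfg : f 0 * g 0 + f 1 * g 1 + f 2 * g 2 = 0 := by
    simp only [hf, hg]; linear_combination horth
  have hdet' : (f 1 * g 2 - f 2 * g 1) * p 0 2 + (f 2 * g 0 - f 0 * g 2) * p 1 2
      + (f 0 * g 1 - f 1 * g 0) * p 2 2 = 1 := by
    simp only [hf, hg]; linear_combination (x ^ 2 + y ^ 2) * hdet + hxy
  have hfpos := sum_three_sq_pos (f := f) (by rintro rfl; simp at hdet')
  have hgpos := sum_three_sq_pos (f := g) (by rintro rfl; simp at hdet')
  have hgf : g 0 ^ 2 + g 1 ^ 2 + g 2 ^ 2 ≤ f 0 ^ 2 + f 1 ^ 2 + f 2 ^ 2 := by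
    simp only [hf, hg]; linarith
  obtain ⟨α, hα, hα2⟩ : ∃ α > 0, α ^ 2 = f 0 ^ 2 + f 1 ^ 2 + f 2 ^ 2 :=
    ⟨_, Real.sqrt_pos.2 hfpos, Real.sq_sqrt hfpos.le⟩
  obtain ⟨β, hβ, hβ2⟩ : ∃ β > 0, β ^ 2 = g 0 ^ 2 + g 1 ^ 2 + g 2 ^ 2 :=
    ⟨_, Real.sqrt_pos.2 hgpos, Real.sq_sqrt hgpos.le⟩
  have hβα : β ≤ α := (sq_le_sq₀ hβ.le hα.le).1 (by linarith)
  obtain ⟨s, hs, hs2⟩ : ∃ s > 0, s ^ 2 = α / β :=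
    ⟨_, Real.sqrt_pos.2 (div_pos hα hβ), Real.sq_sqrt (div_pos hα hβ).le⟩
  have hs2' : s ^ 2 * β = α := by rw [hs2]; field_simp
  have hs1 : 1 ≤ s := by
    have : 1 ≤ α / β := (one_le_div hβ).2 hβα
    nlinarith
  obtain ⟨k, hk0, hk1, hk⟩ := exists_special_orthogonal_of_frame
    (u := fun i => f i / α) (v := fun i => g i / β)
    (by field_simp; linarith) (by field_simp; linarith) (by field_simp; linarith)
  set M := k * stretch s hs.ne' with hM
  have hMc : ∀ i, M i 0 = f i / α * s ∧ M i 1 = g i / β * s⁻¹ := by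
    intro i
    rw [hM, Matrix.SpecialLinearGroup.coe_mul]
    simp [Matrix.mul_apply, Fin.sum_univ_three, stretch, hk0, hk1]
  have hcol0 : (p : Matrix (Fin 3) (Fin 3) ℝ).mulVec ![1, 0, 0] =
      (M : Matrix (Fin 3) (Fin 3) ℝ).mulVec ![x * (s * β), -y * (s * β), 0] := by
    ext i
    simp [Matrix.mulVec, dotProduct, Fin.sum_univ_three, hMc, hp0]
    rw [← hs2']
    field_simp
    ring
  have hcol1 : (p : Matrix (Fin 3) (Fin 3) ℝ).mulVec ![0, 1, 0] =
      (M : Matrix (Fin 3) (Fin 3) ℝ).mulVec ![y * (s * β), x * (s * β), 0] := by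
    ext i
    simp [Matrix.mulVec, dotProduct, Fin.sum_univ_three, hMc, hp1]
    rw [← hs2']
    field_simp
  have hcancel : ∀ v w, (p : Matrix (Fin 3) (Fin 3) ℝ).mulVec v =
      (M : Matrix (Fin 3) (Fin 3) ℝ).mulVec w →
      ((M⁻¹ * p : Matrix.SpecialLinearGroup (Fin 3) ℝ) : Matrix (Fin 3) (Fin 3) ℝ).mulVec v
        = w := by
    intro v w h
    rw [Matrix.SpecialLinearGroup.coe_mul, ← Matrix.mulVec_mulVec, h, Matrix.mulVec_mulVec,
      M.coe_inv_mul_coe, Matrix.one_mulVec]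
  have hn0 := congrFun (hcancel _ _ hcol0)
  have hn1 := congrFun (hcancel _ _ hcol1)
  generalize hn : M⁻¹ * p = n at hn0 hn1
  refine ⟨k, s, hs.ne', n, ?_, hk, hs1, ?_, ?_, ?_, ?_⟩
  · rw [← hn, ← hM, mul_inv_cancel_left]
  · simpa [Matrix.mulVec, dotProduct, Fin.sum_univ_three] using hn0 2
  · simpa [Matrix.mulVec, dotProduct, Fin.sum_univ_three] using hn1 2
  · have h0 := hn0 0
    have h1 := hn1 1
    simp [Matrix.mulVec, dotProduct, Fin.sum_univ_three] at h0 h1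
    rw [h0, h1]
  · have h0 := hn0 1
    have h1 := hn1 0
    simp [Matrix.mulVec, dotProduct, Fin.sum_univ_three] at h0 h1
    rw [h0, h1]

end Decomposition

/-! ### Limits of conjugates under stretches. -/

section StretchLimits

theorem map_conj_mul {G : Type*} [Group G] (H : Subgroup G) (a b : G) :
    H.map (MulAut.conj (a * b)).toMonoidHom =
      (H.map (MulAut.conj b).toMonoidHom).map (MulAut.conj a).toMonoidHom := by
  rw [Subgroup.map_map]
  congr 1
  ext x
  simp [MulAut.conj_apply, mul_assoc]

theorem map_conj_one {G : Type*} [Group G] (H : Subgroup G) :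
    H.map (MulAut.conj (1 : G)).toMonoidHom = H := by
  ext x
  simp

variable {z : ℂ} {L : Subgroup (Matrix.SpecialLinearGroup (Fin 3) ℝ)} {s : ℕ → ℝ}
  {hs : ∀ n, s n ≠ 0}

/-- Conjugation multiplies the entry `(0, 1)` by `s ^ 2`, so convergence forces the imaginary part
of `exp (z * t)` to tend to 0. If `z.re ≠ 0`, the corner makes `t` converge, and its limit must be
an integer multiple of `π / z.im`; if `z.re = 0`, the corner is 1. -/
theorem mem_stretch_limit (hq : Tendsto (fun n => (s n)⁻¹) atTop (𝓝 0)) (hz : z.im ≠ 0)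
    (hL : ChabautyTendsto
      (fun n => (W38 z).map (MulAut.conj (stretch (s n) (hs n))).toMonoidHom) L)
    {A : Matrix.SpecialLinearGroup (Fin 3) ℝ} (hA : A ∈ L) :
    A 1 0 = 0 ∧ A 2 0 = 0 ∧ A 2 1 = 0 ∧ A 1 1 = A 0 0 ∧
      ∃ k : ℤ, A 2 2 = Real.exp (k * (-2 * z.re * (Real.pi / z.im))) := by
  obtain ⟨h, hh, hlim⟩ := hL.1 A hA
  choose B hB hBh using hh
  rw [Matrix.SpecialLinearGroup.tendsto_iff] at hlim
  have hBW := fun n => mem_W38_iff.1 (hB n)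
  choose b20 b21 b11 b10 t h1 h2 using hBW
  have hent : ∀ n, (h n : Matrix (Fin 3) (Fin 3) ℝ) = _ := fun n => by
    exact (congrArg Subtype.val (hBh n).symm).trans (stretch_conj_apply (s n) (hs n) (B n))
  have e20 : A 2 0 = 0 := tendsto_nhds_unique (hlim 2 0) (by simp [hent, b20])
  have e21 : A 2 1 = 0 := tendsto_nhds_unique (hlim 2 1) (by simp [hent, b21])
  have e11 : A 1 1 = A 0 0 :=
    tendsto_nhds_unique (hlim 1 1) (by simpa [hent, b11] using hlim 0 0)
  have hB01 : Tendsto (fun n => B n 0 1) atTop (𝓝 0) := by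
    have := (hq.pow 2).mul (hlim 0 1)
    simp only [hent] at this
    refine Tendsto.congr (fun n => ?_) (by simpa using this)
    exact inv_mul_cancel_left₀ (pow_ne_zero 2 (hs n)) (B n 0 1)
  have e10 : A 1 0 = 0 := by
    refine tendsto_nhds_unique (hlim 1 0) ?_
    have := (hq.pow 2).mul hB01.neg
    simpa [hent, b10] using this
  have hdet := SL3_det_eq_one A
  rw [e20, e21, e11, e10] at hdet
  refine ⟨e10, e20, e21, e11, ?_⟩
  have h22 : ∀ n, h n 2 2 = Real.exp (-2 * z.re * t n) := fun n => by
    rw [hent, h2]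
    simp
  by_cases ha : z.re = 0
  · refine ⟨0, tendsto_nhds_unique (hlim 2 2) ?_⟩
    simp [h22, ha]
  · have hpos : 0 < A 2 2 := by
      have h0 : 0 ≤ A 2 2 := ge_of_tendsto' (hlim 2 2) fun n => by
        rw [h22]; exact (Real.exp_pos _).le
      refine lt_of_le_of_ne h0 fun h => ?_
      rw [← h] at hdet
      simp at hdet
    set τ := Real.log (A 2 2) / (-2 * z.re) with hτ
    have ht : Tendsto t atTop (𝓝 τ) := by
      have : t = fun n => Real.log (h n 2 2) / (-2 * z.re) := by
        ext n
        rw [h22, Real.log_exp]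
        field_simp
      rw [this]
      exact ((hlim 2 2).log hpos.ne').div_const _
    have hsin : Real.exp (z.re * τ) * Real.sin (z.im * τ) = 0 := by
      have hc : Continuous fun r : ℝ => Real.exp (z.re * r) * Real.sin (z.im * r) := by
        fun_prop
      refine tendsto_nhds_unique ((hc.tendsto τ).comp ht) (hB01.congr fun n => ?_)
      have := congrArg Complex.im (h1 n)
      rw [Complex.exp_im] at this
      simpa using this.symm
    obtain ⟨k, hk⟩ := Real.sin_eq_zero_iff.1 ((mul_eq_zero.1 hsin).resolve_left
      (Real.exp_pos _).ne')
    refine ⟨k, ?_⟩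
    have hk' : (k : ℝ) * (-2 * z.re * (Real.pi / z.im)) = -2 * z.re * τ := by
      rw [show (k : ℝ) * (-2 * z.re * (Real.pi / z.im)) = -2 * z.re * (k * Real.pi / z.im) by ring,
        hk, mul_div_cancel_left₀ _ hz]
    rw [hk', hτ, mul_div_cancel₀ _ (by simpa using ha), Real.exp_log hpos]

theorem unipotent_mem_stretch_limit (hq : Tendsto s atTop atTop) (hz : z.im ≠ 0)
    (hL : ChabautyTendsto
      (fun n => (W38 z).map (MulAut.conj (stretch (s n) (hs n))).toMonoidHom) L)
    (x u v : ℝ) : ∃ A ∈ L, (A : Matrix (Fin 3) (Fin 3) ℝ) = !![1, x, u; 0, 1, v; 0, 0, 1] := by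
  -- To first order the imaginary part of `exp (z * t)` is `z.im * t`, so this `t` gives `x` after
  -- multiplication by `s ^ 2`. The column of `B` is prescaled to become exactly `(u, v)` after
  -- conjugation.
  let t : ℕ → ℝ := fun n => (s n ^ 2)⁻¹ * (x / z.im)
  let B : ℕ → Matrix.SpecialLinearGroup (Fin 3) ℝ := fun n =>
    ⟨W38Matrix z (t n) ((s n)⁻¹ * u) (s n * v), det_W38Matrix _ _ _ _⟩
  have hs2 : Tendsto (fun n => s n ^ 2) atTop atTop :=
    (tendsto_pow_atTop two_ne_zero).comp hq
  have ht : Tendsto t atTop (𝓝 0) := by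
    simpa using hs2.inv_tendsto_atTop.mul_const (x / z.im)
  have hre : Tendsto (fun n => (Complex.exp (z * t n)).re) atTop (𝓝 1) := by
    have hc : Continuous fun r : ℝ => (Complex.exp (z * r)).re := by fun_prop
    simpa [Function.comp_def] using (hc.tendsto 0).comp ht
  have him : Tendsto (fun n => (Complex.exp (z * t n)).im) atTop (𝓝 0) := by
    have hc : Continuous fun r : ℝ => (Complex.exp (z * r)).im := by fun_prop
    simpa [Function.comp_def] using (hc.tendsto 0).comp ht
  have hcorner : Tendsto (fun n => Real.exp (-2 * z.re * t n)) atTop (𝓝 1) := by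
    have hc : Continuous fun r : ℝ => Real.exp (-2 * z.re * r) := by fun_prop
    simpa [Function.comp_def] using (hc.tendsto 0).comp ht
  have hx : Tendsto (fun n => s n ^ 2 * (Complex.exp (z * t n)).im) atTop (𝓝 x) := by
    have hd : HasDerivAt (fun r : ℝ => Real.exp (z.re * r) * Real.sin (z.im * r)) z.im 0 := by
      have h1 := ((hasDerivAt_id (0 : ℝ)).const_mul z.re).exp
      have h2 := ((hasDerivAt_id (0 : ℝ)).const_mul z.im).sin
      simpa [Pi.mul_def] using h1.mul h2
    have := (hd.hasFDerivAt.lim_real (x / z.im)).comp hs2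
    simp only [ContinuousLinearMap.toSpanSingleton_apply] at this
    have hxz : (x / z.im) • z.im = x := by simp [hz]
    rw [hxz] at this
    refine this.congr fun n => ?_
    rw [Complex.exp_im]
    simp only [Function.comp_apply, zero_add, mul_zero, Real.sin_zero, sub_zero, smul_eq_mul,
      Complex.re_mul_ofReal, Complex.im_mul_ofReal, t]
  refine ⟨⟨!![1, x, u; 0, 1, v; 0, 0, 1], by simp [Matrix.det_fin_three]⟩, ?_, rfl⟩
  refine hL.2 (fun n => stretch (s n) (hs n) * B n * (stretch (s n) (hs n))⁻¹)
    (fun n => ⟨B n, ⟨_, _, _, rfl⟩, rfl⟩) id strictMono_id _ ?_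
  rw [Function.comp_id]
  refine Matrix.SpecialLinearGroup.tendsto_iff.2 fun i j => ?_
  simp only [stretch_conj_apply]
  fin_cases i <;> fin_cases j <;> simp [B, W38Matrix, hs]
  · exact hre
  · exact hx
  · simpa using (hs2.inv_tendsto_atTop.mul him.neg)
  · exact hre
  · simpa using hcorner

/-- The parametrization of the strictly upper triangular matrices. -/
noncomputable def strictUpperParam : (Fin 3 → ℝ) →ₗ[ℝ] Matrix (Fin 3) (Fin 3) ℝ where
  toFun f := !![0, f 0, f 1; 0, 0, f 2; 0, 0, 0]
  map_add' f g := by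
    ext i j
    fin_cases i <;> fin_cases j <;> simp
  map_smul' c f := by
    ext i j
    fin_cases i <;> fin_cases j <;> simp

theorem strictUpperParam_apply (f : Fin 3 → ℝ) :
    strictUpperParam f = !![0, f 0, f 1; 0, 0, f 2; 0, 0, 0] := rfl

theorem strictUpperParam_injective : Function.Injective strictUpperParam := by
  intro f g h
  have e := fun i j => congrFun (congrFun h i) j
  have h01 : f 0 = g 0 := e 0 1
  have h02 : f 1 = g 1 := e 0 2
  have h12 : f 2 = g 2 := e 1 2
  ext i
  fin_cases i <;> assumption

theorem isClosedOfDim_stretch_limit_atTop (hq : Tendsto s atTop atTop) (hz : z.im ≠ 0)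
    (hL : ChabautyTendsto
      (fun n => (W38 z).map (MulAut.conj (stretch (s n) (hs n))).toMonoidHom) L) :
    IsClosedOfDim L 3 := by
  refine ⟨hL.isClosed, LinearMap.range strictUpperParam, fun X => ⟨?_, fun hX => ?_⟩, ?_⟩
  · rintro ⟨f, rfl⟩ t
    rw [← map_smul, strictUpperParam_apply, exp_strictUpper]
    exact unipotent_mem_stretch_limit hq hz hL _ _ _
  · have key : ∀ t : ℝ, NormedSpace.exp (t • X) 1 0 = 0 ∧ NormedSpace.exp (t • X) 2 0 = 0 ∧
        NormedSpace.exp (t • X) 2 1 = 0 ∧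
        NormedSpace.exp (t • X) 1 1 = NormedSpace.exp (t • X) 0 0 ∧
        (∃ k : ℤ, NormedSpace.exp (t • X) 2 2 =
          Real.exp (k * (-2 * z.re * (Real.pi / z.im)))) ∧
        NormedSpace.exp (t • X) 0 0 ^ 2 * NormedSpace.exp (t • X) 2 2 = 1 := by
      intro t
      obtain ⟨A, hA, h⟩ := hX t
      obtain ⟨h10, h20, h21, h11, h22⟩ := mem_stretch_limit hq.inv_tendsto_atTop hz hL hA
      have hdet := SL3_det_eq_one A
      rw [← h]
      refine ⟨h10, h20, h21, h11, h22, ?_⟩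
      rw [h10, h20, h21, h11] at hdet
      linear_combination hdet
    have x10 : X 1 0 = 0 := linear_eq_zero_of_exp (entryFunctional 1 0) fun t => (key t).1
    have x20 : X 2 0 = 0 := linear_eq_zero_of_exp (entryFunctional 2 0) fun t => (key t).2.1
    have x21 : X 2 1 = 0 := linear_eq_zero_of_exp (entryFunctional 2 1) fun t => (key t).2.2.1
    have x11 : X 1 1 - X 0 0 = 0 :=
      linear_eq_zero_of_exp (entryFunctional 1 1 - entryFunctional 0 0) (c := 0) fun t => by
        simp [(key t).2.2.2.1]
    have e22 : ∀ t : ℝ, NormedSpace.exp (t • X) 2 2 = Real.exp (t * X 2 2) := fun t =>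
      (exp_apply_two_of_row (X := t • X) (by simp [x20]) (by simp [x21])).2.2
    have e00 : ∀ t : ℝ, NormedSpace.exp (t • X) 0 0 = Real.exp (t * X 0 0) := fun t =>
      exp_apply_zero_of_col (X := t • X) (by simp [x10]) (by simp [x20])
    -- Discreteness of the corner values kills the diagonal direction; the determinant then gives `X
    -- 0 0 = 0`.
    have x22 : X 2 2 = 0 := eq_zero_of_forall_exists_int_mul fun t => by
      obtain ⟨k, hk⟩ := (key t).2.2.2.2.1
      rw [e22] at hk
      exact ⟨k, Real.exp_injective hk⟩
    have x00 : X 0 0 = 0 := by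
      have := (key 1).2.2.2.2.2
      rw [e22, e00, x22, ← Real.exp_nat_mul] at this
      simpa using this
    refine ⟨![X 0 1, X 0 2, X 1 2], ?_⟩
    rw [x00, sub_zero] at x11
    rw [strictUpperParam_apply]
    ext i j
    fin_cases i <;> fin_cases j <;>
      simp [x00, x10, x11, x20, x21, x22]
  · rw [LinearMap.finrank_range_of_inj strictUpperParam_injective]
    simp

theorem isClosedOfDim_stretch_limit (hz : z ≠ 0) (hs1 : ∀ n, 1 ≤ s n) {q : ℝ}
    (hq : Tendsto (fun n => (s n)⁻¹) atTop (𝓝 q))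
    (hL : ChabautyTendsto
      (fun n => (W38 z).map (MulAut.conj (stretch (s n) (hs n))).toMonoidHom) L) :
    IsClosedOfDim L 3 := by
  by_cases hb : z.im = 0
  · have hconst : ∀ n, (W38 z).map (MulAut.conj (stretch (s n) (hs n))).toMonoidHom = W38 z :=
      fun n => Subgroup.mem_normalizer_iff_map_conj_eq.1 (stretch_mem_normalizer_W38 hb _ _)
    simp only [hconst] at hL
    rw [hL.eq_of_const (isClosed_W38 hz)]
    exact isClosedOfDim_W38 hz
  by_cases hq0 : q = 0
  · subst hq0
    refine isClosedOfDim_stretch_limit_atTop ?_ hb hL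
    -- Positivity makes the approach to 0 one-sided, so that inverting gives `s → ∞`.
    have h : Tendsto (fun n => (s n)⁻¹) atTop (𝓝[>] 0) :=
      tendsto_nhdsWithin_iff.2 ⟨hq, Eventually.of_forall fun n =>
        inv_pos.2 (zero_lt_one.trans_le (hs1 n))⟩
    simpa [Pi.inv_def] using h.inv_tendsto_nhdsGT_zero
  · have hlim : Tendsto (fun n => (stretch (s n) (hs n))⁻¹) atTop
        (𝓝 (stretch q hq0)) := by
      rw [Matrix.SpecialLinearGroup.tendsto_iff]
      have hs' : Tendsto s atTop (𝓝 q⁻¹) := by simpa using hq.inv₀ hq0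
      intro i j
      have he : ∀ n, (stretch (s n) (hs n))⁻¹ = stretch (s n)⁻¹ (inv_ne_zero (hs n)) :=
        fun n => stretch_inv _ _
      simp only [he]
      fin_cases i <;> fin_cases j <;> simp [stretch, hq, hs']
    refine IsClosedOfDim.of_map_conj (stretch q hq0) ?_
    -- Undoing the stretches makes the sequence constant, and the conjugate of `L` is `W38 z`
    -- itself.
    have h := hL.conj hlim
    simp only [← map_conj_mul, inv_mul_cancel, map_conj_one] at h
    rw [h.eq_of_const (isClosed_W38 hz)]
    exact isClosedOfDim_W38 hz

end StretchLimits

/-! ### Reduction of arbitrary conjugators to stretches. -/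

theorem isClosedOfDim_of_isConjugacyLimit_W38 {z : ℂ} (hz : z ≠ 0)
    {L : Subgroup (Matrix.SpecialLinearGroup (Fin 3) ℝ)} (hL : IsConjugacyLimit (W38 z) L) :
    IsClosedOfDim L 3 := by
  obtain ⟨p, hp⟩ := hL
  choose k s hs n hpn hk hs1 h20 h21 h11 h10 using
    fun m => exists_compact_mul_stretch_mul_normalizer (p m)
  -- Using `s⁻¹` in place of `s` keeps the parameter in a compact interval, with `q = 0` standing
  -- for `s → ∞`.
  obtain ⟨⟨k₀, q⟩, -, ψ, hψ, hlim⟩ := (isCompact_entries_le_one.prod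
    (isCompact_Icc (a := (0 : ℝ)) (b := 1))).tendsto_subseq (x := fun m => (k m, (s m)⁻¹))
    fun m => ⟨hk m, inv_nonneg.2 (zero_le_one.trans (hs1 m)), inv_le_one_of_one_le₀ (hs1 m)⟩
  have hk₀ : Tendsto (fun m => (k (ψ m))⁻¹) atTop (𝓝 k₀⁻¹) :=
    ((continuous_fst.tendsto _).comp hlim).inv
  have hq : Tendsto (fun m => (s (ψ m))⁻¹) atTop (𝓝 q) := (continuous_snd.tendsto _).comp hlim
  refine IsClosedOfDim.of_map_conj k₀⁻¹ ?_
  refine isClosedOfDim_stretch_limit (s := s ∘ ψ) (hs := fun m => hs (ψ m)) hz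
    (fun m => hs1 _) hq ?_
  have hconj : ∀ m, ((W38 z).map (MulAut.conj (p m)).toMonoidHom).map
      (MulAut.conj (k m)⁻¹).toMonoidHom =
        (W38 z).map (MulAut.conj (stretch (s m) (hs m))).toMonoidHom := fun m => by
    rw [← map_conj_mul, hpn m, mul_assoc, inv_mul_cancel_left, map_conj_mul]
    congr 1
    exact Subgroup.mem_normalizer_iff_map_conj_eq.1
      (mem_normalizer_W38 (h20 m) (h21 m) (h11 m) (h10 m))
  have h := (hp.comp_strictMono hψ).conj hk₀
  simp only [Function.comp_apply, hconj] at h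
  exact h

theorem mainTheorem4 (z : ℂ) (hz : z ≠ 0)
    (L : Subgroup (Matrix.SpecialLinearGroup (Fin 3) ℝ))
    (hL : IsConjugacyLimit (W38 z) L ∨ IsConjugacyLimit (W39 z) L) :
    IsClosedOfDim L 3 := by
  rcases hL with hL | hL
  · exact isClosedOfDim_of_isConjugacyLimit_W38 hz hL
  · have h := hL.map dualAut continuous_dualAut continuous_dualAut
    rw [map_dualAut_W39] at h
    exact (isClosedOfDim_of_isConjugacyLimit_W38 hz h).of_map_dualAut
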